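/- Let $A\in\mathbb R^{m\times n}$, $B\in\mathbb R^{m\times l}$, $b\in\mathbb R^m$, let $f:\mathbb R^n\to(-\infty,+\infty]$ and $g:\mathbb R^l\to(-\infty,+\infty]$ be closed proper convex functions, let $\lambda,\tau,\sigma>0$ and $\gamma\in(0,2)$. For the problem $$\min\{f(x)+g(z): Ax+Bz=b\}\tag{1}$$ consider the method G-PCPM-III, which from $(x^k,z^k,y^k)$ computes $$\begin{aligned}p^{k+1}&=y^k+\lambda(Ax^k+Bz^k-b),\\ x^{k+1}&=\arg\min_x\{f(x)+\langle p^{k+1},Ax\rangle+\tfrac1{2\tau}\|x-x^k\|^2\},\\ z^{k+1}&=\arg\min_z\{g(z)+\langle p^{k+1},Bz\rangle+\tfrac1{2\sigma}\|z-z^k\|^2\},\\ y^{k+1}&=y^k+\gamma\lambda(Ax^{k+1}+Bz^{k+1}-b).\end{aligned}$$ (i) The method is well defined: every starting point $(x^0,z^0,y^0)$ gives exactly one sequence. (ii) It is a proximal augmented Lagrangian method (ALM): with $u=(x;z)$, $\theta(u)=f(x)+g(z)$, $M=[A\ B]$ and $$P=\begin{pmatrix}\frac1\tau I&0\\0&\frac1\sigma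 I\end{pmatrix}-\lambda M^\top M=\begin{pmatrix}\frac1\tau I-\lambda A^\top A&-\lambda A^\top B\\-\lambda B^\top A&\frac1\sigma I-\lambda B^\top B\end{pmatrix},$$ a sequence $(x^k,z^k,y^k)$ is generated by G-PCPM-III if and only if, for all $k$, with $u^k=(x^k;z^k)$ and $\|v\|_P^2=v^\top Pv$ (where $P$ may be indefinite), $$u^{k+1}\in\arg\min_u\{\theta(u)+\langle y^k,Mu-b\rangle+\tfrac\lambda2\|Mu-b\|^2+\tfrac12\|u-u^k\|_P^2\},\qquad y^{k+1}=y^k+\gamma\lambda(Mu^{k+1}-b).$$ (iii) Suppose that (1) has a solution (with finite value) and, unless $f$ and $g$ are both finite everywhere, that the Lagrangian $f(x)+g(z)+\langle y,Ax+Bz-b\rangle$ has a saddle point. If, with the spectral norm, $$\lambda\tau\|A^\top A\|+\lambda\sigma\|B^\top B\|<\frac4{2+\gamma},$$ then for every starting point the sequence $(x^k,z^k,y^k)$ converges to a saddle point $(x^\infty,z^\infty,y^\infty)$ of the Lagrangian; in particular $(x^k,z^k)$ converges to a solution $(x^\infty,z^\infty)$ of (1). -/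

import Mathlib

open Set Filter Topology
open scoped Matrix

noncomputable section

namespace PCPM

/-- `ℝᵐ` for an arbitrary finite index type, with the Euclidean norm. -/
abbrev Vec (ι : Type) : Type := EuclideanSpace ℝ ι

/-- The vector `A x`. -/
def app {ι κ : Type} [Fintype ι] [Fintype κ] [DecidableEq ι]
    (A : Matrix κ ι ℝ) (x : Vec ι) : Vec κ :=
  WithLp.toLp 2 (A *ᵥ WithLp.ofLp x)

/-- The spectral norm (the `ℓ²` operator norm) of a square matrix. -/
def specNorm {ι : Type} [Fintype ι] [DecidableEq ι] (C : Matrix ι ι ℝ) : ℝ :=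
  ‖Matrix.toEuclideanCLM (n := ι) (𝕜 := ℝ) C‖

/-- The (possibly indefinite) quadratic form `‖v‖²_P = vᵀ P v`. -/
def quad {ι : Type} [Fintype ι] (P : Matrix ι ι ℝ) (v : Vec ι) : ℝ :=
  WithLp.ofLp v ⬝ᵥ (P *ᵥ WithLp.ofLp v)

/-- Closed proper convex functions `ℝⁿ → (-∞, +∞]`. Convexity is convexity of the epigraph. -/
structure ClosedProperConvex {ι : Type} [Fintype ι] (f : Vec ι → EReal) : Prop where
  ne_bot : ∀ x, f x ≠ ⊥
  exists_ne_top : ∃ x, f x ≠ ⊤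
  lsc : LowerSemicontinuous f
  convex_epi : Convex ℝ {q : Vec ι × ℝ | f q.1 ≤ (q.2 : EReal)}

/-! ### The proximal augmented Lagrangian method for `min {θ u : M u = b}` -/

section ProximalALM

variable {ι κ : Type} [Fintype ι] [Fintype κ] [DecidableEq ι]

/-- The augmented Lagrangian `θ u + ⟨y, M u - b⟩ + (lam / 2) ‖M u - b‖²`. -/
def augLagrangian (θ : Vec ι → EReal) (M : Matrix κ ι ℝ) (b : Vec κ) (lam : ℝ)
    (u : Vec ι) (y : Vec κ) : EReal :=
  θ u + ((inner ℝ y (app M u - b) + lam / 2 * ‖app M u - b‖ ^ 2 : ℝ) : EReal)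

/-- `(u, y)` is a run of the proximal augmented Lagrangian method with penalty parameter `lam`,
relaxation factor `γ` and proximal matrix `P`. -/
structure IsProximalALMRun (θ : Vec ι → EReal) (M : Matrix κ ι ℝ) (b : Vec κ) (lam γ : ℝ)
    (P : Matrix ι ι ℝ) (u : ℕ → Vec ι) (y : ℕ → Vec κ) : Prop where
  primal : ∀ k, IsMinOn
    (fun v => augLagrangian θ M b lam v (y k) + ((1 / 2 * quad P (v - u k) : ℝ) : EReal))
    univ (u (k + 1))
  dual : ∀ k, y (k + 1) = y k + (γ * lam) • (app M (u (k + 1)) - b)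

end ProximalALM

/-! ### The problem `min {f x + g z : A x + B z = b}` and the method G-PCPM-III -/

section Separable

variable {n l m : ℕ}

/-- `(x, z)` is a solution of `min {f x + g z : A x + B z = b}`, with finite optimal value. -/
structure IsSolution (f : Vec (Fin n) → EReal) (g : Vec (Fin l) → EReal)
    (A : Matrix (Fin m) (Fin n) ℝ) (B : Matrix (Fin m) (Fin l) ℝ) (b : Vec (Fin m))
    (x : Vec (Fin n)) (z : Vec (Fin l)) : Prop where
  feasible : app A x + app B z = b
  finite : f x + g z ≠ ⊤
  optimal : ∀ x' z', app A x' + app B z' = b → f x + g z ≤ f x' + g z'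

/-- The Lagrangian `f x + g z + ⟨y, A x + B z - b⟩`. -/
def lagrangian (f : Vec (Fin n) → EReal) (g : Vec (Fin l) → EReal)
    (A : Matrix (Fin m) (Fin n) ℝ) (B : Matrix (Fin m) (Fin l) ℝ) (b : Vec (Fin m))
    (w : Vec (Fin n) × Vec (Fin l)) (y : Vec (Fin m)) : EReal :=
  f w.1 + g w.2 + ((inner ℝ y (app A w.1 + app B w.2 - b) : ℝ) : EReal)

/-- `((x, z), y)` is a saddle point of the Lagrangian (`y` is then a Lagrange multiplier). -/
def IsSaddle (f : Vec (Fin n) → EReal) (g : Vec (Fin l) → EReal)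
    (A : Matrix (Fin m) (Fin n) ℝ) (B : Matrix (Fin m) (Fin l) ℝ) (b : Vec (Fin m))
    (x : Vec (Fin n)) (z : Vec (Fin l)) (y : Vec (Fin m)) : Prop :=
  IsSaddlePointOn univ univ (lagrangian f g A B b) (x, z) y

/-- The predicted multiplier `p = y + lam (A x + B z - b)`. -/
def predictor (A : Matrix (Fin m) (Fin n) ℝ) (B : Matrix (Fin m) (Fin l) ℝ) (b : Vec (Fin m))
    (lam : ℝ) (x : Vec (Fin n)) (z : Vec (Fin l)) (y : Vec (Fin m)) : Vec (Fin m) :=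
  y + lam • (app A x + app B z - b)

/-- `(x, z, y)` is a run of G-PCPM-III with dual parameter `lam`, primal parameters `τ`, `σ` and
relaxation factor `γ`. -/
structure IsGPCPM3Run (f : Vec (Fin n) → EReal) (g : Vec (Fin l) → EReal)
    (A : Matrix (Fin m) (Fin n) ℝ) (B : Matrix (Fin m) (Fin l) ℝ) (b : Vec (Fin m))
    (lam τ σ γ : ℝ)
    (x : ℕ → Vec (Fin n)) (z : ℕ → Vec (Fin l)) (y : ℕ → Vec (Fin m)) : Prop where
  step_x : ∀ k, IsMinOn
    (fun ξ => f ξ + ((inner ℝ (predictor A B b lam (x k) (z k) (y k)) (app A ξ)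
      + 1 / (2 * τ) * ‖ξ - x k‖ ^ 2 : ℝ) : EReal))
    univ (x (k + 1))
  step_z : ∀ k, IsMinOn
    (fun ζ => g ζ + ((inner ℝ (predictor A B b lam (x k) (z k) (y k)) (app B ζ)
      + 1 / (2 * σ) * ‖ζ - z k‖ ^ 2 : ℝ) : EReal))
    univ (z (k + 1))
  step_y : ∀ k, y (k + 1) = y k + (γ * lam) • (app A (x (k + 1)) + app B (z (k + 1)) - b)

/-- The stacked vector `u = (x; z)`. -/
def stack (x : Vec (Fin n)) (z : Vec (Fin l)) : Vec (Fin n ⊕ Fin l) :=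
  WithLp.toLp 2 (Sum.elim (WithLp.ofLp x) (WithLp.ofLp z))

/-- The separable objective `θ (x; z) = f x + g z`. -/
def sepObjective (f : Vec (Fin n) → EReal) (g : Vec (Fin l) → EReal)
    (u : Vec (Fin n ⊕ Fin l)) : EReal :=
  f (WithLp.toLp 2 fun i => WithLp.ofLp u (Sum.inl i)) +
    g (WithLp.toLp 2 fun j => WithLp.ofLp u (Sum.inr j))

/-- `P = diag (I / τ, I / σ) - lam [A B]ᵀ [A B]`. -/
def proxMatrix (A : Matrix (Fin m) (Fin n) ℝ) (B : Matrix (Fin m) (Fin l) ℝ) (lam τ σ : ℝ) :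
    Matrix (Fin n ⊕ Fin l) (Fin n ⊕ Fin l) ℝ :=
  Matrix.fromBlocks ((1 / τ) • (1 : Matrix (Fin n) (Fin n) ℝ)) 0 0
      ((1 / σ) • (1 : Matrix (Fin l) (Fin l) ℝ))
    - lam • ((Matrix.fromCols A B)ᵀ * Matrix.fromCols A B)

end Separable

end PCPM

end

/-!
The method is studied through first-order conditions. A minimizer of the proximal subproblem for
`f` at the predicted multiplier `p` satisfies `-Aᵀp - (x₁ - x)/τ ∈ ∂f x₁`
(`ClosedProperConvex.hasSubgradientAt_of_isMinOn`), and likewise for `g`. Monotonicity of the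
subdifferential makes the minimizer unique; it exists because a closed proper convex function
decreases at most linearly (`ClosedProperConvex.exists_linear_lower_bound`), so that the proximal
term makes the objective coercive.

For the equivalence with the proximal augmented Lagrangian method, expand the penalty term: the
part `-lam MᵀM` of `P` cancels the quadratic coupling of `x` and `z`, and what remains is the sum
of the two proximal objectives at the predicted multiplier and a constant
(`augLagrangian_add_quad_stack`). A sum of proper functions of separate variables is minimal
exactly where both summands are.

For convergence, saddle points are KKT points (`IsSaddle.isKKT`, `IsKKT.isSaddle`), and one exists
also when `f` and `g` are finite everywhere, by separating the strict epigraph of `f + g` from the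
feasible set at the optimal level (`IsSolution.exists_isKKT`). Fix a KKT point `(x', z', y')`, let
`r = A x + B z - b` be the residual, and put `‖(x, z)‖_D² = ‖x‖²/τ + ‖z‖²/σ`. With
`W = ‖y - y'‖²/(γ lam) + ‖(x - x', z - z')‖_D² - (γ/2) lam ‖r‖²`, monotonicity gives
(`lyapunov_step`)

`W₁ ≤ W - (‖Δ‖_D² - (2 + γ)/4 lam ‖r₁ - r‖²) - (2 - γ)/4 lam ‖r₁ + r‖²`,

where `Δ` is the primal step. The step size condition and
`lam ‖A x + B z‖² ≤ (lam τ ‖AᵀA‖ + lam σ ‖BᵀB‖) ‖(x, z)‖_D²` (`norm_app_add_app_sq_le`) make the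
first bracket at least a positive multiple of `‖Δ‖_D²`; as `γ/2 < (2 + γ)/4`, they also make `W`
positive definite. Hence the run is bounded, and `Δ` and `r` tend to zero. Since the graph of a
subdifferential is closed (`HasSubgradientAt.of_tendsto`), every limit point is a KKT point. The
function `W` at that limit point is antitone and vanishes along a subsequence, so it tends to zero
and the whole run converges.
-/

namespace PCPM

/-! ### Subgradients and proximal minimizers of closed proper convex functions -/

section Convex

variable {ι : Type} [Fintype ι] {f : Vec ι → EReal}

/-- `v` is a subgradient of the extended-real-valued function `f` at `x`. Finiteness of `f x` is
part of the notion: otherwise every `v` would qualify where `f` is identically `⊤`. -/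
structure HasSubgradientAt (f : Vec ι → EReal) (v x : Vec ι) : Prop where
  ne_top : f x ≠ ⊤
  le : ∀ ξ, f x + ((inner ℝ v (ξ - x) : ℝ) : EReal) ≤ f ξ

lemma ClosedProperConvex.exists_real (hf : ClosedProperConvex f) {x : Vec ι} (hx : f x ≠ ⊤) :
    ∃ r : ℝ, f x = r :=
  ⟨(f x).toReal, (EReal.coe_toReal hx (hf.ne_bot x)).symm⟩

lemma ClosedProperConvex.le_add_smul_sub (hf : ClosedProperConvex f) {x y : Vec ι} {a b s : ℝ}
    (hx : f x ≤ a) (hy : f y ≤ b) (hs₀ : 0 ≤ s) (hs₁ : s ≤ 1) :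
    f (x + s • (y - x)) ≤ ((a + s * (b - a) : ℝ) : EReal) := by
  have h := hf.convex_epi (x := (x, a)) hx (y := (y, b)) hy (sub_nonneg.2 hs₁) hs₀ (by ring)
  have e : (1 - s) • (x, a) + s • (y, b) = (x + s • (y - x), a + s * (b - a)) := by
    ext1
    · simp only [Prod.fst_add, Prod.smul_fst]; module
    · simp only [Prod.snd_add, Prod.smul_snd, smul_eq_mul]; ring
  rw [e] at h
  exact h

/-- A subgradient inequality is tested against points of finite value only. -/
lemma ClosedProperConvex.hasSubgradientAt_of_real (hf : ClosedProperConvex f) {v x : Vec ι} {r : ℝ}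
    (hx : f x = r) (h : ∀ ξ (t : ℝ), f ξ = t → r + inner ℝ v (ξ - x) ≤ t) :
    HasSubgradientAt f v x := by
  refine ⟨by simp [hx], fun ξ => ?_⟩
  by_cases hξ : f ξ = ⊤
  · simp [hξ]
  · obtain ⟨t, ht⟩ := hf.exists_real hξ
    rw [hx, ht, ← EReal.coe_add]
    exact EReal.coe_le_coe_iff.2 (h ξ t ht)

/-- The subdifferential is a monotone operator. -/
lemma HasSubgradientAt.inner_nonneg (hf : ClosedProperConvex f) {v w x y : Vec ι}
    (hx : HasSubgradientAt f v x) (hy : HasSubgradientAt f w y) :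
    0 ≤ inner ℝ (v - w) (x - y) := by
  obtain ⟨r, hr⟩ := hf.exists_real hx.ne_top
  obtain ⟨t, ht⟩ := hf.exists_real hy.ne_top
  have h₁ := hx.le y
  have h₂ := hy.le x
  rw [hr, ht, ← EReal.coe_add, EReal.coe_le_coe_iff] at h₁ h₂
  rw [inner_sub_left]
  have : inner ℝ v (y - x) = -inner ℝ v (x - y) := by rw [← inner_neg_right, neg_sub]
  linarith

/-- The graph of the subdifferential of a closed convex function is closed. -/
lemma HasSubgradientAt.of_tendsto (hf : ClosedProperConvex f) {v x : ℕ → Vec ι} {v' x' : Vec ι}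
    (h : ∀ k, HasSubgradientAt f (v k) (x k)) (hv : Tendsto v atTop (𝓝 v'))
    (hx : Tendsto x atTop (𝓝 x')) : HasSubgradientAt f v' x' := by
  have key : ∀ ξ (t : ℝ), f ξ = t → f x' ≤ ((t - inner ℝ v' (ξ - x') : ℝ) : EReal) := by
    intro ξ t ht
    have hlim : Tendsto (fun k => ((t - inner ℝ (v k) (ξ - x k) : ℝ) : EReal)) atTop
        (𝓝 ((t - inner ℝ v' (ξ - x') : ℝ) : EReal)) :=
      (continuous_coe_real_ereal.tendsto _).comp
        (tendsto_const_nhds.sub (hv.inner (tendsto_const_nhds.sub hx)))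
    refine le_of_forall_lt_imp_le_of_dense fun c hc => ge_of_tendsto hlim ?_
    filter_upwards [hx.eventually (hf.lsc x' c hc)] with k hk
    obtain ⟨r, hr⟩ := hf.exists_real (h k).ne_top
    have h₁ := (h k).le ξ
    rw [hr, ht, ← EReal.coe_add, EReal.coe_le_coe_iff] at h₁
    rw [hr] at hk
    exact hk.le.trans (EReal.coe_le_coe_iff.2 (by linarith))
  obtain ⟨x₀, hx₀⟩ := hf.exists_ne_top
  obtain ⟨a, ha⟩ := hf.exists_real hx₀
  obtain ⟨r, hr⟩ := hf.exists_real ((key x₀ a ha).trans_lt (EReal.coe_lt_top _)).ne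
  refine hf.hasSubgradientAt_of_real hr fun ξ t ht => ?_
  have h₁ := key ξ t ht
  rw [hr, EReal.coe_le_coe_iff] at h₁
  linarith

/-- A minimizer of `f + ⟨c, ·⟩ + ‖· - x‖² / (2τ)` satisfies the first-order optimality
condition. -/
lemma ClosedProperConvex.hasSubgradientAt_of_isMinOn (hf : ClosedProperConvex f) {c x p : Vec ι}
    {τ : ℝ} (h : IsMinOn (fun ξ => f ξ + ((inner ℝ c ξ + 1 / (2 * τ) * ‖ξ - x‖ ^ 2 : ℝ) : EReal))
      univ p) : HasSubgradientAt f (-c - (1 / τ) • (p - x)) p := by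
  obtain ⟨x₀, hx₀⟩ := hf.exists_ne_top
  obtain ⟨a, ha⟩ := hf.exists_real hx₀
  have hp : f p ≠ ⊤ := by
    intro hp
    have := h (mem_univ x₀)
    simp only [mem_ofPred_eq, hp, ha, EReal.top_add_coe, ← EReal.coe_add, top_le_iff] at this
    exact EReal.coe_ne_top _ this
  obtain ⟨r, hr⟩ := hf.exists_real hp
  refine hf.hasSubgradientAt_of_real hr fun ξ t ht => ?_
  -- Compare `p` with the points `p + s (ξ - p)` and let `s → 0`.
  set K : ℝ := 1 / (2 * τ) * ‖ξ - p‖ ^ 2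
  set D : ℝ := inner ℝ (-c - (1 / τ) • (p - x)) (ξ - p)
  have hs : ∀ s ∈ Ioc (0 : ℝ) 1, r + D - t ≤ s * K := by
    rintro s ⟨hs₀, hs₁⟩
    have h₁ := h (mem_univ (p + s • (ξ - p)))
    have h₂ := hf.le_add_smul_sub hr.le ht.le hs₀.le hs₁
    have h₃ := h₁.trans (add_le_add_left h₂ _)
    simp only [hr, ← EReal.coe_add, EReal.coe_le_coe_iff] at h₃
    have e₁ : ‖p + s • (ξ - p) - x‖ ^ 2
        = ‖p - x‖ ^ 2 + 2 * (s * inner ℝ (p - x) (ξ - p)) + s ^ 2 * ‖ξ - p‖ ^ 2 := by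
      rw [add_sub_right_comm, norm_add_sq_real, inner_smul_right, norm_smul, mul_pow,
        Real.norm_eq_abs, sq_abs]
    have e₂ : D = -inner ℝ c (ξ - p) - 1 / τ * inner ℝ (p - x) (ξ - p) := by
      simp only [D, inner_sub_left, inner_neg_left, real_inner_smul_left]
    rw [e₁, inner_add_right, inner_smul_right] at h₃
    have e₃ : 1 / (2 * τ) = 1 / 2 * (1 / τ) := by rw [one_div_mul_one_div]
    have h₄ : s * (r + D - t) ≤ s * (s * K) := by
      simp only [K, e₂]; rw [e₃] at h₃ ⊢; linarith
    exact le_of_mul_le_mul_left h₄ hs₀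
  have hlim : Tendsto (fun s : ℝ => s * K) (𝓝[>] 0) (𝓝 0) := by
    have : Tendsto (fun s : ℝ => s * K) (𝓝 0) (𝓝 (0 * K)) := tendsto_id.mul_const K
    rw [zero_mul] at this
    exact this.mono_left nhdsWithin_le_nhds
  have := ge_of_tendsto hlim (Filter.eventually_of_mem (Ioc_mem_nhdsGT one_pos) hs)
  linarith

lemma ClosedProperConvex.isMinOn_unique (hf : ClosedProperConvex f) {c x p q : Vec ι} {τ : ℝ}
    (hτ : 0 < τ)
    (hp : IsMinOn (fun ξ => f ξ + ((inner ℝ c ξ + 1 / (2 * τ) * ‖ξ - x‖ ^ 2 : ℝ) : EReal)) univ p)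
    (hq : IsMinOn (fun ξ => f ξ + ((inner ℝ c ξ + 1 / (2 * τ) * ‖ξ - x‖ ^ 2 : ℝ) : EReal)) univ q) :
    p = q := by
  have h := (hf.hasSubgradientAt_of_isMinOn hp).inner_nonneg hf (hf.hasSubgradientAt_of_isMinOn hq)
  have e : (-c - (1 / τ) • (p - x)) - (-c - (1 / τ) • (q - x)) = -((1 / τ) • (p - q)) := by module
  rw [e, inner_neg_left, real_inner_smul_left, real_inner_self_eq_norm_sq] at h
  have h₁ : 0 < 1 / τ := by positivity
  have h₂ : ‖p - q‖ ^ 2 = 0 := by nlinarith [sq_nonneg ‖p - q‖]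
  exact sub_eq_zero.1 (norm_eq_zero.1 (pow_eq_zero_iff two_ne_zero |>.1 h₂))

/-- A closed proper convex function decreases at most linearly: lower semicontinuity bounds it
below on a ball around a point of its domain, and convexity propagates the bound. -/
lemma ClosedProperConvex.exists_linear_lower_bound (hf : ClosedProperConvex f) :
    ∃ (x₀ : Vec ι) (a C : ℝ), f x₀ = a ∧ 0 ≤ C ∧
      ∀ ξ (t : ℝ), f ξ = t → a - C * (1 + ‖ξ - x₀‖) ≤ t := by
  obtain ⟨x₀, hx₀⟩ := hf.exists_ne_top
  obtain ⟨a, ha⟩ := hf.exists_real hx₀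
  have hmem : x₀ ∈ Metric.closedBall x₀ (1 : ℝ) := Metric.mem_closedBall_self zero_le_one
  obtain ⟨x₁, -, hmin⟩ := LowerSemicontinuousOn.exists_isMinOn ⟨x₀, hmem⟩
    (isCompact_closedBall x₀ (1 : ℝ)) (hf.lsc.lowerSemicontinuousOn _)
  have h₁₀ : f x₁ ≤ a := ha ▸ hmin hmem
  obtain ⟨m, hm⟩ := hf.exists_real (h₁₀.trans_lt (EReal.coe_lt_top a)).ne
  have hma : m ≤ a := by rwa [hm, EReal.coe_le_coe_iff] at h₁₀
  refine ⟨x₀, a, a - m, ha, sub_nonneg.2 hma, fun ξ t ht => ?_⟩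
  have hn := norm_nonneg (ξ - x₀)
  rcases le_or_gt ‖ξ - x₀‖ 1 with h | h
  · have hmt : f x₁ ≤ f ξ := hmin (mem_closedBall_iff_norm.2 h)
    rw [hm, ht, EReal.coe_le_coe_iff] at hmt
    nlinarith
  · have hpos : 0 < ‖ξ - x₀‖ := zero_lt_one.trans h
    have h₁ := hf.le_add_smul_sub ha.le ht.le (inv_nonneg.2 hn) (inv_le_one_of_one_le₀ h.le)
    have h₂ : f x₁ ≤ f (x₀ + ‖ξ - x₀‖⁻¹ • (ξ - x₀)) := by
      refine hmin (mem_closedBall_iff_norm.2 ?_)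
      rw [add_sub_cancel_left, norm_smul, norm_inv, norm_norm, inv_mul_cancel₀ hpos.ne']
    have h₃ := h₂.trans h₁
    rw [hm, EReal.coe_le_coe_iff] at h₃
    have h₄ : ‖ξ - x₀‖ * (‖ξ - x₀‖⁻¹ * (t - a)) = t - a := by field_simp
    nlinarith

lemma ClosedProperConvex.exists_isMinOn (hf : ClosedProperConvex f) (c x : Vec ι) {τ : ℝ}
    (hτ : 0 < τ) : ∃ p, IsMinOn
      (fun ξ => f ξ + ((inner ℝ c ξ + 1 / (2 * τ) * ‖ξ - x‖ ^ 2 : ℝ) : EReal)) univ p := by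
  obtain ⟨x₀, a, C, ha, hC, hlow⟩ := hf.exists_linear_lower_bound
  set q : Vec ι → ℝ := fun ξ => inner ℝ c ξ + 1 / (2 * τ) * ‖ξ - x‖ ^ 2 with hq
  have hqc : Continuous q := by fun_prop
  have hlsc : LowerSemicontinuous fun ξ => f ξ + (q ξ : EReal) := by
    refine hf.lsc.add' (continuous_coe_real_ereal.comp hqc).lowerSemicontinuous fun ξ => ?_
    exact EReal.continuousAt_add (by simp) (by simp)
  -- The objective is at least `d² / (2τ) - K₂ d - K₁ + (f + q) x₀` at distance `d` from `x`.
  set K₁ : ℝ := C * (1 + ‖x - x₀‖) + ‖c‖ * ‖x‖ + |q x₀|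
  set K₂ : ℝ := C + ‖c‖
  have hK₁ : 0 ≤ K₁ := by positivity
  have hK₂ : 0 ≤ K₂ := by positivity
  set R : ℝ := 2 * τ * (K₁ + K₂) + 1
  have hfar : ∀ ξ, f ξ + (q ξ : EReal) ≤ f x₀ + (q x₀ : EReal) → ξ ∈ Metric.closedBall x R := by
    intro ξ hξ
    have hξt : f ξ ≠ ⊤ := by
      intro ht
      rw [ht, ha, ← EReal.coe_add, EReal.top_add_coe, top_le_iff] at hξ
      exact EReal.coe_ne_top _ hξ
    obtain ⟨t, ht⟩ := hf.exists_real hξt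
    rw [ht, ha, ← EReal.coe_add, ← EReal.coe_add, EReal.coe_le_coe_iff] at hξ
    have h₁ := hlow ξ t ht
    have h₂ : ‖ξ - x₀‖ ≤ ‖ξ - x‖ + ‖x - x₀‖ := norm_sub_le_norm_sub_add_norm_sub _ _ _
    have h₃ : ‖ξ‖ ≤ ‖ξ - x‖ + ‖x‖ := by simpa using norm_add_le (ξ - x) x
    have h₄ : -(‖c‖ * ‖ξ‖) ≤ inner ℝ c ξ := (abs_le.1 (abs_real_inner_le_norm c ξ)).1
    have h₅ := mul_le_mul_of_nonneg_left h₂ hC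
    have h₆ := mul_le_mul_of_nonneg_left h₃ (norm_nonneg c)
    have h₇ := le_abs_self (q x₀)
    have h₈ : q ξ = inner ℝ c ξ + 1 / (2 * τ) * ‖ξ - x‖ ^ 2 := rfl
    have h₉ : 1 / (2 * τ) * ‖ξ - x‖ ^ 2 ≤ K₁ + K₂ * ‖ξ - x‖ := by
      simp only [K₁, K₂]; linarith
    have h₁₀ : ‖ξ - x‖ ^ 2 ≤ 2 * τ * (K₁ + K₂ * ‖ξ - x‖) := by
      rw [one_div, inv_mul_le_iff₀ (by positivity)] at h₉
      exact h₉
    rw [mem_closedBall_iff_norm]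
    by_contra hlt
    push Not at hlt
    have h₁₁ : 1 < ‖ξ - x‖ := lt_of_le_of_lt (le_add_of_nonneg_left (by positivity)) hlt
    have h₁₂ : 0 ≤ 2 * τ * K₁ * (‖ξ - x‖ - 1) :=
      mul_nonneg (by positivity) (sub_nonneg.2 h₁₁.le)
    have h₁₃ : (2 * τ * (K₁ + K₂) + 1) * ‖ξ - x‖ ≤ ‖ξ - x‖ * ‖ξ - x‖ :=
      mul_le_mul_of_nonneg_right hlt.le (norm_nonneg _)
    linarith
  have hx₀ := hfar x₀ le_rfl
  obtain ⟨p, -, hp⟩ := LowerSemicontinuousOn.exists_isMinOn ⟨x₀, hx₀⟩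
    (isCompact_closedBall x R) (hlsc.lowerSemicontinuousOn _)
  refine ⟨p, fun ξ _ => ?_⟩
  by_cases hξ : ξ ∈ Metric.closedBall x R
  · exact hp hξ
  · have h₁ : f x₀ + (q x₀ : EReal) ≤ f ξ + (q ξ : EReal) :=
      (not_le.1 fun h => hξ (hfar ξ h)).le
    exact (hp hx₀ : _ ≤ _).trans h₁

end Convex

/-! ### The linear map of a matrix -/

section App

variable {ι κ : Type} [Fintype ι] [Fintype κ] [DecidableEq ι]

lemma app_eq_toEuclideanLin (A : Matrix κ ι ℝ) (x : Vec ι) :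
    app A x = Matrix.toEuclideanLin A x := rfl

lemma app_sub (A : Matrix κ ι ℝ) (x y : Vec ι) : app A (x - y) = app A x - app A y := by
  simp only [app_eq_toEuclideanLin, map_sub]

@[fun_prop]
lemma continuous_app (A : Matrix κ ι ℝ) : Continuous (app A) :=
  (Matrix.toEuclideanLin A).continuous_of_finiteDimensional

lemma inner_app_right [DecidableEq κ] (A : Matrix κ ι ℝ) (p : Vec κ) (x : Vec ι) :
    inner ℝ p (app A x) = inner ℝ (app Aᵀ p) x := by
  rw [app_eq_toEuclideanLin, app_eq_toEuclideanLin, ← Matrix.conjTranspose_eq_transpose_of_trivial,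
    Matrix.toEuclideanLin_conjTranspose_eq_adjoint, LinearMap.adjoint_inner_left]

lemma norm_app_sq_le [DecidableEq κ] (A : Matrix κ ι ℝ) (x : Vec ι) :
    ‖app A x‖ ^ 2 ≤ specNorm (Aᵀ * A) * ‖x‖ ^ 2 := by
  have e : app Aᵀ (app A x) = Matrix.toEuclideanCLM (n := ι) (𝕜 := ℝ) (Aᵀ * A) x := by
    ext i
    simp [app, Matrix.mulVec_mulVec]
  rw [← real_inner_self_eq_norm_sq, inner_app_right, e]
  calc _ ≤ ‖Matrix.toEuclideanCLM (n := ι) (𝕜 := ℝ) (Aᵀ * A) x‖ * ‖x‖ := real_inner_le_norm _ _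
    _ ≤ specNorm (Aᵀ * A) * ‖x‖ * ‖x‖ := by
        gcongr; exact ContinuousLinearMap.le_opNorm _ _
    _ = _ := by ring

end App

section Blocks

variable {n l m : ℕ}

/-- The weighted spectral bound `lam ‖A x + B z‖² ≤ K (‖x‖² / τ + ‖z‖² / σ)` with
`K = lam τ ‖AᵀA‖ + lam σ ‖BᵀB‖`, from the Cauchy-Schwarz inequality. -/
lemma norm_app_add_app_sq_le (A : Matrix (Fin m) (Fin n) ℝ) (B : Matrix (Fin m) (Fin l) ℝ)
    {lam τ σ : ℝ} (hlam : 0 < lam) (hτ : 0 < τ) (hσ : 0 < σ) (x : Vec (Fin n)) (z : Vec (Fin l)) :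
    lam * ‖app A x + app B z‖ ^ 2 ≤
      (lam * τ * specNorm (Aᵀ * A) + lam * σ * specNorm (Bᵀ * B)) *
        (1 / τ * ‖x‖ ^ 2 + 1 / σ * ‖z‖ ^ 2) := by
  set α := specNorm (Aᵀ * A)
  set β := specNorm (Bᵀ * B)
  have hα : 0 ≤ α := norm_nonneg _
  have hβ : 0 ≤ β := norm_nonneg _
  have hA : ‖app A x‖ ^ 2 ≤ α * ‖x‖ ^ 2 := norm_app_sq_le A x
  have hB : ‖app B z‖ ^ 2 ≤ β * ‖z‖ ^ 2 := norm_app_sq_le B z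
  have hs : ‖app A x + app B z‖ ^ 2 ≤ (‖app A x‖ + ‖app B z‖) ^ 2 :=
    pow_le_pow_left₀ (norm_nonneg _) (norm_add_le _ _) 2
  set X := √τ⁻¹ * ‖x‖
  set Z := √σ⁻¹ * ‖z‖
  have hX : X ^ 2 = 1 / τ * ‖x‖ ^ 2 := by
    rw [mul_pow, Real.sq_sqrt (by positivity), one_div]
  have hZ : Z ^ 2 = 1 / σ * ‖z‖ ^ 2 := by
    rw [mul_pow, Real.sq_sqrt (by positivity), one_div]
  have hA' : ‖app A x‖ ≤ √(τ * α) * X := by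
    refine abs_le_of_sq_le_sq' ?_ (by positivity) |>.2
    rw [mul_pow, Real.sq_sqrt (by positivity), hX]
    calc _ ≤ _ := hA
      _ = _ := by field_simp
  have hB' : ‖app B z‖ ≤ √(σ * β) * Z := by
    refine abs_le_of_sq_le_sq' ?_ (by positivity) |>.2
    rw [mul_pow, Real.sq_sqrt (by positivity), hZ]
    calc _ ≤ _ := hB
      _ = _ := by field_simp
  have hsum : (‖app A x‖ + ‖app B z‖) ^ 2 ≤ (√(τ * α) * X + √(σ * β) * Z) ^ 2 := by gcongr
  have hcs : (√(τ * α) * X + √(σ * β) * Z) ^ 2 ≤ (τ * α + σ * β) * (X ^ 2 + Z ^ 2) := by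
    have h₁ : √(τ * α) ^ 2 = τ * α := Real.sq_sqrt (by positivity)
    have h₂ : √(σ * β) ^ 2 = σ * β := Real.sq_sqrt (by positivity)
    nlinarith [sq_nonneg (√(τ * α) * Z - √(σ * β) * X)]
  rw [← hX, ← hZ]
  calc _ ≤ lam * ((τ * α + σ * β) * (X ^ 2 + Z ^ 2)) := by
        gcongr; exact hs.trans (hsum.trans hcs)
    _ = _ := by ring

/-! ### Equivalence with the proximal augmented Lagrangian method -/

lemma app_fromCols_stack (A : Matrix (Fin m) (Fin n) ℝ) (B : Matrix (Fin m) (Fin l) ℝ)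
    (x : Vec (Fin n)) (z : Vec (Fin l)) :
    app (Matrix.fromCols A B) (stack x z) = app A x + app B z := by
  ext i
  simp [app, stack, Matrix.fromCols_mulVec]

lemma stack_sub (x x' : Vec (Fin n)) (z z' : Vec (Fin l)) :
    stack x z - stack x' z' = stack (x - x') (z - z') := by
  ext i
  cases i <;> simp [stack]

lemma exists_eq_stack (u : Vec (Fin n ⊕ Fin l)) : ∃ x z, u = stack x z := by
  refine ⟨WithLp.toLp 2 fun i => u (Sum.inl i), WithLp.toLp 2 fun j => u (Sum.inr j), ?_⟩
  ext i
  cases i <;> rfl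

lemma quad_proxMatrix_stack (A : Matrix (Fin m) (Fin n) ℝ) (B : Matrix (Fin m) (Fin l) ℝ)
    (lam τ σ : ℝ) (x : Vec (Fin n)) (z : Vec (Fin l)) :
    quad (proxMatrix A B lam τ σ) (stack x z) =
      1 / τ * ‖x‖ ^ 2 + 1 / σ * ‖z‖ ^ 2 - lam * ‖app A x + app B z‖ ^ 2 := by
  have h₁ : ‖app A x + app B z‖ ^ 2 =
      WithLp.ofLp (stack x z) ⬝ᵥ
        (((Matrix.fromCols A B)ᵀ * Matrix.fromCols A B) *ᵥ WithLp.ofLp (stack x z)) := by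
    rw [← app_fromCols_stack, ← real_inner_self_eq_norm_sq, ← Matrix.mulVec_mulVec,
      Matrix.dotProduct_mulVec, Matrix.vecMul_transpose]
    rfl
  have h₂ : ∀ {k : ℕ} (v : Vec (Fin k)), ‖v‖ ^ 2 = WithLp.ofLp v ⬝ᵥ WithLp.ofLp v := by
    intro k v
    rw [← real_inner_self_eq_norm_sq]
    rfl
  rw [quad, proxMatrix, Matrix.sub_mulVec, dotProduct_sub, Matrix.smul_mulVec, dotProduct_smul,
    ← h₁, h₂ x, h₂ z]
  simp [stack, Matrix.fromBlocks_mulVec, Matrix.smul_mulVec]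

lemma proxMatrix_eq_fromBlocks (A : Matrix (Fin m) (Fin n) ℝ) (B : Matrix (Fin m) (Fin l) ℝ)
    (lam τ σ : ℝ) : proxMatrix A B lam τ σ =
      Matrix.fromBlocks ((1 / τ) • 1 - lam • (Aᵀ * A)) (-(lam • (Aᵀ * B)))
        (-(lam • (Bᵀ * A))) ((1 / σ) • 1 - lam • (Bᵀ * B)) := by
  rw [proxMatrix, Matrix.transpose_fromCols, Matrix.fromRows_mul_fromCols, Matrix.fromBlocks_smul,
    sub_eq_add_neg, Matrix.fromBlocks_neg, Matrix.fromBlocks_add]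
  simp [sub_eq_add_neg]

lemma isMinOn_add_iff {α β : Type*} {F : α → EReal} {G : β → EReal} (hF : ∀ a, F a ≠ ⊥)
    (hF' : ∃ a, F a ≠ ⊤) (hG : ∀ b, G b ≠ ⊥) (hG' : ∃ b, G b ≠ ⊤) (c : ℝ) (p : α) (q : β) :
    (∀ a b, F p + G q + (c : EReal) ≤ F a + G b + (c : EReal)) ↔
      IsMinOn F univ p ∧ IsMinOn G univ q := by
  constructor
  · intro h
    obtain ⟨a, ha⟩ := hF'
    obtain ⟨b, hb⟩ := hG'
    have hfin : F p + G q + (c : EReal) < ⊤ :=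
      (h a b).trans_lt (EReal.add_lt_top (EReal.add_lt_top ha hb).ne (EReal.coe_ne_top c))
    have hp : F p ≠ ⊤ := fun hp => by simp [hp, EReal.top_add_of_ne_bot (hG q)] at hfin
    have hq : G q ≠ ⊤ := fun hq => by simp [hq, EReal.add_top_of_ne_bot (hF p)] at hfin
    lift F p to ℝ using ⟨hp, hF p⟩ with r hr
    lift G q to ℝ using ⟨hq, hG q⟩ with s hs
    constructor
    · intro x _
      have hx := h x q
      by_cases hxt : F x = ⊤
      · simp [hxt]
      lift F x to ℝ using ⟨hxt, hF x⟩ with t ht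
      rw [← hs] at hx
      simp only [← EReal.coe_add, EReal.coe_le_coe_iff] at hx
      simp only [mem_ofPred_eq, ← hr, ← ht, EReal.coe_le_coe_iff]
      linarith
    · intro x _
      have hx := h p x
      by_cases hxt : G x = ⊤
      · simp [hxt]
      lift G x to ℝ using ⟨hxt, hG x⟩ with t ht
      rw [← hr] at hx
      simp only [← EReal.coe_add, EReal.coe_le_coe_iff] at hx
      simp only [mem_ofPred_eq, ← hs, ← ht, EReal.coe_le_coe_iff]
      linarith
  · rintro ⟨h₁, h₂⟩ a b
    exact add_le_add_left (add_le_add (h₁ (mem_univ a)) (h₂ (mem_univ b))) _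

variable {f : Vec (Fin n) → EReal} {g : Vec (Fin l) → EReal}

/-- In the proximal augmented Lagrangian, the matrix `P` cancels the quadratic coupling of the
penalty term; what is left separates into the two proximal objectives at the predicted
multiplier, up to a constant. -/
lemma augLagrangian_add_quad_stack (A : Matrix (Fin m) (Fin n) ℝ) (B : Matrix (Fin m) (Fin l) ℝ)
    (b : Vec (Fin m)) (lam τ σ : ℝ) (x ξ : Vec (Fin n)) (z ζ : Vec (Fin l)) (y : Vec (Fin m)) :
    augLagrangian (sepObjective f g) (Matrix.fromCols A B) b lam (stack ξ ζ) y +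
        ((1 / 2 * quad (proxMatrix A B lam τ σ) (stack ξ ζ - stack x z) : ℝ) : EReal) =
      (f ξ + ((inner ℝ (predictor A B b lam x z y) (app A ξ)
        + 1 / (2 * τ) * ‖ξ - x‖ ^ 2 : ℝ) : EReal)) +
      (g ζ + ((inner ℝ (predictor A B b lam x z y) (app B ζ)
        + 1 / (2 * σ) * ‖ζ - z‖ ^ 2 : ℝ) : EReal)) +
      ((lam / 2 * (‖b‖ ^ 2 - ‖app A x + app B z‖ ^ 2) - inner ℝ y b : ℝ) : EReal) := by
  have hsep : sepObjective f g (stack ξ ζ) = f ξ + g ζ := rfl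
  have hreal : inner ℝ y (app A ξ + app B ζ - b) + lam / 2 * ‖app A ξ + app B ζ - b‖ ^ 2 +
      1 / 2 * (1 / τ * ‖ξ - x‖ ^ 2 + 1 / σ * ‖ζ - z‖ ^ 2 -
        lam * ‖app A (ξ - x) + app B (ζ - z)‖ ^ 2) =
      (inner ℝ (predictor A B b lam x z y) (app A ξ) + 1 / (2 * τ) * ‖ξ - x‖ ^ 2) +
      (inner ℝ (predictor A B b lam x z y) (app B ζ) + 1 / (2 * σ) * ‖ζ - z‖ ^ 2) +
      (lam / 2 * (‖b‖ ^ 2 - ‖app A x + app B z‖ ^ 2) - inner ℝ y b) := by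
    have e₁ : app A (ξ - x) + app B (ζ - z) = (app A ξ + app B ζ) - (app A x + app B z) := by
      rw [app_sub, app_sub]; abel
    have e₂ : ∀ p : Vec (Fin m), inner ℝ p (app A ξ) + inner ℝ p (app B ζ) =
        inner ℝ p (app A ξ + app B ζ) := fun p => (inner_add_right _ _ _).symm
    have e₃ := e₂ (predictor A B b lam x z y)
    rw [e₁]
    set s := app A ξ + app B ζ
    set t := app A x + app B z
    have e₄ : inner ℝ (predictor A B b lam x z y) s =
        inner ℝ y s + lam * (inner ℝ s t - inner ℝ s b) := by
      change inner ℝ (y + lam • (t - b)) s = _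
      rw [inner_add_left, real_inner_smul_left, inner_sub_left, real_inner_comm s t,
        real_inner_comm s b]
    rw [e₄] at e₃
    rw [norm_sub_sq_real s b, norm_sub_sq_real s t, inner_sub_right, ← one_div_mul_one_div,
      ← one_div_mul_one_div]
    linarith
  rw [augLagrangian, hsep, app_fromCols_stack, stack_sub, quad_proxMatrix_stack, add_assoc,
    ← EReal.coe_add, hreal, EReal.coe_add, EReal.coe_add]
  ac_rfl

lemma add_coe_ne_bot {a : EReal} (ha : a ≠ ⊥) (r : ℝ) : a + (r : EReal) ≠ ⊥ := by
  simp [EReal.add_eq_bot_iff, ha]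

theorem isGPCPM3Run_iff_isProximalALMRun (hf : ClosedProperConvex f) (hg : ClosedProperConvex g)
    (A : Matrix (Fin m) (Fin n) ℝ) (B : Matrix (Fin m) (Fin l) ℝ) (b : Vec (Fin m))
    (lam τ σ γ : ℝ) (x : ℕ → Vec (Fin n)) (z : ℕ → Vec (Fin l)) (y : ℕ → Vec (Fin m)) :
    IsGPCPM3Run f g A B b lam τ σ γ x z y ↔
      IsProximalALMRun (sepObjective f g) (Matrix.fromCols A B) b lam γ
        (proxMatrix A B lam τ σ) (fun k => stack (x k) (z k)) y := by
  have hmin := fun k => isMinOn_add_iff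
    (F := fun ξ => f ξ + ((inner ℝ (predictor A B b lam (x k) (z k) (y k)) (app A ξ)
      + 1 / (2 * τ) * ‖ξ - x k‖ ^ 2 : ℝ) : EReal))
    (G := fun ζ => g ζ + ((inner ℝ (predictor A B b lam (x k) (z k) (y k)) (app B ζ)
      + 1 / (2 * σ) * ‖ζ - z k‖ ^ 2 : ℝ) : EReal))
    (fun ξ => add_coe_ne_bot (hf.ne_bot ξ) _)
    (hf.exists_ne_top.imp fun ξ hξ => (EReal.add_lt_top hξ (EReal.coe_ne_top _)).ne)
    (fun ζ => add_coe_ne_bot (hg.ne_bot ζ) _)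
    (hg.exists_ne_top.imp fun ζ hζ => (EReal.add_lt_top hζ (EReal.coe_ne_top _)).ne)
    (lam / 2 * (‖b‖ ^ 2 - ‖app A (x k) + app B (z k)‖ ^ 2) - inner ℝ (y k) b)
    (x (k + 1)) (z (k + 1))
  simp only [← augLagrangian_add_quad_stack] at hmin
  constructor
  · rintro ⟨hx, hz, hy⟩
    refine ⟨fun k u _ => ?_, fun k => ?_⟩
    · obtain ⟨ξ, ζ, rfl⟩ := exists_eq_stack u
      exact (hmin k).2 ⟨hx k, hz k⟩ ξ ζ
    · rw [app_fromCols_stack]; exact hy k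
  · rintro ⟨hu, hy⟩
    have h := fun k => (hmin k).1 fun ξ ζ => hu k (mem_univ (stack ξ ζ))
    exact ⟨fun k => (h k).1, fun k => (h k).2, fun k => by rw [hy k, app_fromCols_stack]⟩

/-! ### Well-posedness of the iteration -/

theorem existsUnique_isGPCPM3Run (hf : ClosedProperConvex f) (hg : ClosedProperConvex g)
    (A : Matrix (Fin m) (Fin n) ℝ) (B : Matrix (Fin m) (Fin l) ℝ) (b : Vec (Fin m))
    (lam : ℝ) {τ σ : ℝ} (γ : ℝ) (hτ : 0 < τ) (hσ : 0 < σ)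
    (w₀ : Vec (Fin n) × Vec (Fin l) × Vec (Fin m)) :
    ∃! w : ℕ → Vec (Fin n) × Vec (Fin l) × Vec (Fin m), w 0 = w₀ ∧
      IsGPCPM3Run f g A B b lam τ σ γ
        (fun k => (w k).1) (fun k => (w k).2.1) (fun k => (w k).2.2) := by
  have hx : ∀ (p : Vec (Fin m)) (x : Vec (Fin n)), ∃ x', IsMinOn
      (fun ξ => f ξ + ((inner ℝ p (app A ξ) + 1 / (2 * τ) * ‖ξ - x‖ ^ 2 : ℝ) : EReal))
      univ x' := fun p x => by
    simp only [inner_app_right]; exact hf.exists_isMinOn _ x hτ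
  have hz : ∀ (p : Vec (Fin m)) (z : Vec (Fin l)), ∃ z', IsMinOn
      (fun ζ => g ζ + ((inner ℝ p (app B ζ) + 1 / (2 * σ) * ‖ζ - z‖ ^ 2 : ℝ) : EReal))
      univ z' := fun p z => by
    simp only [inner_app_right]; exact hg.exists_isMinOn _ z hσ
  choose X hX using hx
  choose Z hZ using hz
  let step : Vec (Fin n) × Vec (Fin l) × Vec (Fin m) → Vec (Fin n) × Vec (Fin l) × Vec (Fin m) :=
    fun w =>
      let p := predictor A B b lam w.1 w.2.1 w.2.2
      (X p w.1, Z p w.2.1, w.2.2 + (γ * lam) • (app A (X p w.1) + app B (Z p w.2.1) - b))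
  refine ⟨fun k => step^[k] w₀, ⟨rfl, ?_⟩, ?_⟩
  · refine ⟨fun k => ?_, fun k => ?_, fun k => ?_⟩ <;> simp only [Function.iterate_succ_apply']
    · exact hX _ _
    · exact hZ _ _
    · rfl
  · rintro w ⟨h₀, hw⟩
    funext k
    induction k with
    | zero => exact h₀
    | succ k ih =>
      have h₁ := hw.step_x k
      have h₂ := hw.step_z k
      have h₃ := hw.step_y k
      have h₄ := hX (predictor A B b lam (w k).1 (w k).2.1 (w k).2.2) (w k).1
      have h₅ := hZ (predictor A B b lam (w k).1 (w k).2.1 (w k).2.2) (w k).2.1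
      simp only [inner_app_right] at h₁ h₂ h₄ h₅
      have e₁ := hf.isMinOn_unique hτ h₁ h₄
      have e₂ := hg.isMinOn_unique hσ h₂ h₅
      rw [Function.iterate_succ_apply', ← ih]
      refine Prod.ext e₁ (Prod.ext e₂ ?_)
      rw [h₃, e₁, e₂]

end Blocks

/-! ### Saddle points, the KKT conditions and Lagrange multipliers -/

section Saddle

variable {n l m : ℕ} {f : Vec (Fin n) → EReal} {g : Vec (Fin l) → EReal}
  {A : Matrix (Fin m) (Fin n) ℝ} {B : Matrix (Fin m) (Fin l) ℝ} {b : Vec (Fin m)}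
  {x : Vec (Fin n)} {z : Vec (Fin l)} {y : Vec (Fin m)}

/-- The KKT conditions of `min {f x + g z : A x + B z = b}`: feasibility, `-Aᵀy ∈ ∂f x` and
`-Bᵀy ∈ ∂g z`. -/
structure IsKKT (f : Vec (Fin n) → EReal) (g : Vec (Fin l) → EReal)
    (A : Matrix (Fin m) (Fin n) ℝ) (B : Matrix (Fin m) (Fin l) ℝ) (b : Vec (Fin m))
    (x : Vec (Fin n)) (z : Vec (Fin l)) (y : Vec (Fin m)) : Prop where
  feasible : app A x + app B z = b
  subgradient_x : HasSubgradientAt f (-app Aᵀ y) x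
  subgradient_z : HasSubgradientAt g (-app Bᵀ y) z

lemma IsSaddle.isKKT (hf : ClosedProperConvex f) (hg : ClosedProperConvex g)
    (h : IsSaddle f g A B b x z y) : IsKKT f g A B b x z y := by
  have hL : ∀ ξ ζ y', f x + g z + ((inner ℝ y' (app A x + app B z - b) : ℝ) : EReal) ≤
      f ξ + g ζ + ((inner ℝ y (app A ξ + app B ζ - b) : ℝ) : EReal) :=
    fun ξ ζ y' => h (ξ, ζ) (mem_univ _) y' (mem_univ _)
  obtain ⟨x₀, hx₀⟩ := hf.exists_ne_top
  obtain ⟨z₀, hz₀⟩ := hg.exists_ne_top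
  obtain ⟨α, hα⟩ := hf.exists_real hx₀
  obtain ⟨β, hβ⟩ := hg.exists_real hz₀
  have hfin := (hL x₀ z₀ y).trans_lt
    (EReal.add_lt_top (EReal.add_lt_top hx₀ hz₀).ne (EReal.coe_ne_top _))
  have hx : f x ≠ ⊤ := fun hx => by simp [hx, EReal.top_add_of_ne_bot (hg.ne_bot z)] at hfin
  have hz : g z ≠ ⊤ := fun hz => by simp [hz, EReal.add_top_of_ne_bot (hf.ne_bot x)] at hfin
  obtain ⟨r, hr⟩ := hf.exists_real hx
  obtain ⟨s, hs⟩ := hg.exists_real hz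
  -- The Lagrangian at `(x, z)` is bounded above in the multiplier, so the residual vanishes.
  have hfeas : app A x + app B z - b = 0 := by
    by_contra hd
    set d := app A x + app B z - b
    have hd' : ‖d‖ ^ 2 ≠ 0 := pow_ne_zero 2 (norm_ne_zero_iff.2 hd)
    set c := α + β + inner ℝ y (app A x₀ + app B z₀ - b)
    have h₁ := hL x₀ z₀ (((c - r - s + 1) / ‖d‖ ^ 2) • d)
    rw [hr, hs, hα, hβ, real_inner_smul_left, real_inner_self_eq_norm_sq,
      div_mul_cancel₀ _ hd'] at h₁
    simp only [← EReal.coe_add, EReal.coe_le_coe_iff] at h₁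
    linarith
  have hAB : app A x + app B z = b := sub_eq_zero.1 hfeas
  refine ⟨hAB, hf.hasSubgradientAt_of_real hr fun ξ t ht => ?_,
    hg.hasSubgradientAt_of_real hs fun ζ t ht => ?_⟩
  · have h₁ := hL ξ z y
    have e : app A ξ + app B z - b = app A (ξ - x) := by rw [app_sub, ← hAB]; abel
    rw [hr, hs, ht, hfeas, inner_zero_right, e, inner_app_right] at h₁
    simp only [← EReal.coe_add, EReal.coe_le_coe_iff] at h₁
    rw [inner_neg_left]
    linarith
  · have h₁ := hL x ζ y
    have e : app A x + app B ζ - b = app B (ζ - z) := by rw [app_sub, ← hAB]; abel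
    rw [hr, hs, ht, hfeas, inner_zero_right, e, inner_app_right] at h₁
    simp only [← EReal.coe_add, EReal.coe_le_coe_iff] at h₁
    rw [inner_neg_left]
    linarith

lemma IsKKT.isSaddle (hf : ClosedProperConvex f) (hg : ClosedProperConvex g)
    (h : IsKKT f g A B b x z y) : IsSaddle f g A B b x z y := by
  rintro ⟨ξ, ζ⟩ - y' -
  obtain ⟨r, hr⟩ := hf.exists_real h.subgradient_x.ne_top
  obtain ⟨s, hs⟩ := hg.exists_real h.subgradient_z.ne_top
  simp only [lagrangian]
  rw [sub_eq_zero.2 h.feasible, inner_zero_right]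
  by_cases hξ : f ξ = ⊤
  · rw [hξ, EReal.top_add_of_ne_bot (hg.ne_bot ζ), EReal.top_add_coe]
    exact le_top
  by_cases hζ : g ζ = ⊤
  · rw [hζ, EReal.add_top_of_ne_bot (hf.ne_bot ξ), EReal.top_add_coe]
    exact le_top
  obtain ⟨t, ht⟩ := hf.exists_real hξ
  obtain ⟨t', ht'⟩ := hg.exists_real hζ
  have h₁ := h.subgradient_x.le ξ
  have h₂ := h.subgradient_z.le ζ
  have e : app A ξ + app B ζ - b = app A (ξ - x) + app B (ζ - z) := by
    rw [app_sub, app_sub, ← h.feasible]; abel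
  rw [e, inner_add_right, inner_app_right, inner_app_right]
  rw [inner_neg_left] at h₁ h₂
  rw [hr, ht] at h₁
  rw [hs, ht'] at h₂
  rw [hr, hs, ht, ht']
  simp only [← EReal.coe_add, EReal.coe_le_coe_iff] at h₁ h₂ ⊢
  linarith

lemma IsKKT.isSolution (hf : ClosedProperConvex f) (hg : ClosedProperConvex g)
    (h : IsKKT f g A B b x z y) : IsSolution f g A B b x z := by
  refine ⟨h.feasible, (EReal.add_lt_top h.subgradient_x.ne_top h.subgradient_z.ne_top).ne,
    fun x' z' h' => ?_⟩
  have := h.isSaddle hf hg (x', z') (mem_univ _) y (mem_univ _)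
  simpa [lagrangian, h.feasible, h'] using this

lemma ClosedProperConvex.convexOn_toReal (hf : ClosedProperConvex f) (hfin : ∀ x, f x ≠ ⊤) :
    ConvexOn ℝ univ fun x => (f x).toReal := by
  have hcoe : ∀ x, f x = (((f x).toReal : ℝ) : EReal) := fun x =>
    (EReal.coe_toReal (hfin x) (hf.ne_bot x)).symm
  refine ⟨convex_univ, fun x _ y _ s t hs ht hst => ?_⟩
  have h := hf.le_add_smul_sub (hcoe x).le (hcoe y).le ht (by linarith)
  have e : x + t • (y - x) = s • x + t • y := by rw [← eq_sub_iff_add_eq] at hst; subst hst; module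
  rw [e, hcoe (s • x + t • y), EReal.coe_le_coe_iff] at h
  refine h.trans_eq ?_
  rw [← eq_sub_iff_add_eq] at hst
  subst hst
  simp only [smul_eq_mul]
  ring

/-- Lagrange multipliers exist when `f` and `g` are finite everywhere. The open convex set
`{(w, t) : f w.1 + g w.2 < t}` is separated from the affine set of all `(w, v)` with `w` feasible
and `v` the optimal value; the separating functional vanishes on the kernel of `w ↦ A w.1 + B w.2`,
hence factors through it. -/
theorem IsSolution.exists_isKKT (hf : ClosedProperConvex f) (hg : ClosedProperConvex g)
    (hffin : ∀ x, f x ≠ ⊤) (hgfin : ∀ z, g z ≠ ⊤) (h : IsSolution f g A B b x z) :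
    ∃ y, IsKKT f g A B b x z y := by
  set F : Vec (Fin n) → ℝ := fun x => (f x).toReal
  set G : Vec (Fin l) → ℝ := fun z => (g z).toReal
  have hF : ∀ x, f x = (F x : EReal) := fun x => (EReal.coe_toReal (hffin x) (hf.ne_bot x)).symm
  have hG : ∀ z, g z = (G z : EReal) := fun z => (EReal.coe_toReal (hgfin z) (hg.ne_bot z)).symm
  have hFconv : ConvexOn ℝ univ F := hf.convexOn_toReal hffin
  have hGconv : ConvexOn ℝ univ G := hg.convexOn_toReal hgfin
  set θ : Vec (Fin n) × Vec (Fin l) → ℝ := fun w => F w.1 + G w.2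
  have hθconv : ConvexOn ℝ univ θ :=
    (hFconv.comp_linearMap (LinearMap.fst ℝ (Vec (Fin n)) (Vec (Fin l)))).add
      (hGconv.comp_linearMap (LinearMap.snd ℝ (Vec (Fin n)) (Vec (Fin l))))
  have hFc : Continuous F := hFconv.locallyLipschitz.continuous
  have hGc : Continuous G := hGconv.locallyLipschitz.continuous
  have hθc : Continuous θ := by fun_prop
  set M : Vec (Fin n) × Vec (Fin l) →ₗ[ℝ] Vec (Fin m) :=
    (Matrix.toEuclideanLin A).coprod (Matrix.toEuclideanLin B)
  have hM : ∀ w, M w = app A w.1 + app B w.2 := fun w => rfl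
  set S : Set ((Vec (Fin n) × Vec (Fin l)) × ℝ) := {q | θ q.1 < q.2}
  set T : Set ((Vec (Fin n) × Vec (Fin l)) × ℝ) := {q | M q.1 = b ∧ q.2 = θ (x, z)}
  have hS : Convex ℝ S := by
    have := hθconv.convex_strict_epigraph
    simpa only [mem_univ, true_and] using this
  have hSo : IsOpen S := isOpen_lt (hθc.comp continuous_fst) continuous_snd
  have hT : Convex ℝ T := by
    rintro ⟨w, t⟩ ⟨h₁, h₂⟩ ⟨w', t'⟩ ⟨h₃, h₄⟩ α β - - hαβ
    simp only at h₁ h₂ h₃ h₄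
    refine ⟨?_, ?_⟩
    · simp only [Prod.smul_mk, Prod.mk_add_mk, map_add, map_smul, h₁, h₃]
      rw [← add_smul, hαβ, one_smul]
    · simp only [Prod.smul_mk, Prod.mk_add_mk, h₂, h₄]
      rw [← add_smul, hαβ, one_smul]
  have hST : Disjoint S T := by
    rw [Set.disjoint_left]
    rintro ⟨w, t⟩ h₁ ⟨h₂, h₃⟩
    have h₄ := h.optimal w.1 w.2 h₂
    rw [hF, hG, hF, hG] at h₄
    simp only [← EReal.coe_add, EReal.coe_le_coe_iff] at h₄
    have h₅ : θ w < t := h₁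
    have h₆ : t = F x + G z := h₃
    have h₇ : θ w = F w.1 + G w.2 := rfl
    linarith
  obtain ⟨φ, c, hφS, hφT⟩ := geometric_hahn_banach_open hS hSo hT hST
  set κ : ℝ := φ (0, 1)
  set ψ : (Vec (Fin n) × Vec (Fin l)) →ₗ[ℝ] ℝ := φ.toLinearMap ∘ₗ LinearMap.inl ℝ _ ℝ
  have hφ : ∀ w t, φ (w, t) = ψ w + t * κ := by
    intro w t
    have : (w, t) = (w, (0 : ℝ)) + t • ((0 : Vec (Fin n) × Vec (Fin l)), (1 : ℝ)) := by simp
    rw [this, map_add, map_smul, smul_eq_mul]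
    rfl
  have hfeas : M (x, z) = b := h.feasible
  have h₀ : c ≤ ψ (x, z) + θ (x, z) * κ := by
    rw [← hφ]; exact hφT _ ⟨hfeas, rfl⟩
  have hκ : κ < 0 := by
    have h₁ : φ ((x, z), θ (x, z) + 1) < c := hφS _ (lt_add_one (θ (x, z)))
    rw [hφ] at h₁
    linarith
  have hle : ∀ w, ψ w + θ w * κ ≤ c := by
    intro w
    by_contra hlt
    push Not at hlt
    have hpos : 0 < (ψ w + θ w * κ - c) / (-κ) := div_pos (sub_pos.2 hlt) (neg_pos.2 hκ)
    have h₁ : φ (w, θ w + (ψ w + θ w * κ - c) / (-κ)) < c := hφS _ (lt_add_of_pos_right _ hpos)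
    rw [hφ, add_mul] at h₁
    have h₂ : (ψ w + θ w * κ - c) / (-κ) * κ = -(ψ w + θ w * κ - c) := by
      field_simp [hκ.ne]
    linarith
  have hker : ψ ∈ M.ker.dualAnnihilator := by
    rw [Submodule.mem_dualAnnihilator]
    intro v hv
    -- A linear functional bounded below on a line through `(x, z)` vanishes on its direction.
    by_contra hne
    have h₁ := hφT ((x, z) + ((c - ψ (x, z) - θ (x, z) * κ - 1) / ψ v) • v, θ (x, z))
      ⟨by simp [hfeas, LinearMap.mem_ker.1 hv], rfl⟩
    rw [hφ, map_add, map_smul, smul_eq_mul, div_mul_cancel₀ _ hne] at h₁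
    linarith
  rw [← LinearMap.range_dualMap_eq_dualAnnihilator_ker] at hker
  obtain ⟨μ, hμ⟩ := hker
  set y₀ : Vec (Fin m) := (InnerProductSpace.toDual ℝ (Vec (Fin m))).symm μ.toContinuousLinearMap
  have hy₀ : ∀ v, inner ℝ y₀ v = μ v := fun v => by
    rw [InnerProductSpace.toDual_symm_apply]; rfl
  have hψ : ∀ w, ψ w = inner ℝ y₀ (M w) := fun w => by rw [hy₀, ← hμ]; rfl
  have key : ∀ w, θ (x, z) ≤ θ w + inner ℝ (κ⁻¹ • y₀) (M w - b) := by
    intro w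
    have h₁ := (hle w).trans h₀
    rw [hψ, hψ, hfeas] at h₁
    rw [real_inner_smul_left, inner_sub_right]
    have h₂ : κ * (θ w + κ⁻¹ * (inner ℝ y₀ (M w) - inner ℝ y₀ b)) ≤ κ * θ (x, z) := by
      rw [mul_add, mul_inv_cancel_left₀ hκ.ne]
      linarith
    exact (mul_le_mul_left_of_neg hκ).1 h₂
  refine ⟨κ⁻¹ • y₀, IsSaddle.isKKT hf hg ?_⟩
  rintro ⟨ξ, ζ⟩ - y' -
  simp only [lagrangian]
  rw [sub_eq_zero.2 h.feasible, inner_zero_right, hF, hG, hF, hG]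
  simp only [← EReal.coe_add, EReal.coe_le_coe_iff]
  rw [add_zero]
  exact key (ξ, ζ)

end Saddle

/-! ### Convergence -/

section Convergence

variable {n l m : ℕ} {f : Vec (Fin n) → EReal} {g : Vec (Fin l) → EReal}
  {A : Matrix (Fin m) (Fin n) ℝ} {B : Matrix (Fin m) (Fin l) ℝ} {b : Vec (Fin m)}
  {lam τ σ γ : ℝ}

/-- The Lyapunov function of the method relative to the reference point `(x', z', y')`: weighted
squared distances to the point, minus a multiple of the squared residual (for feasible `(x', z')`).
The step size condition makes it positive definite. -/
noncomputable def lyapunov (A : Matrix (Fin m) (Fin n) ℝ) (B : Matrix (Fin m) (Fin l) ℝ) (lam τ σ γ : ℝ)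
    (x' : Vec (Fin n)) (z' : Vec (Fin l)) (y' : Vec (Fin m))
    (x : Vec (Fin n)) (z : Vec (Fin l)) (y : Vec (Fin m)) : ℝ :=
  1 / (γ * lam) * ‖y - y'‖ ^ 2 + 1 / τ * ‖x - x'‖ ^ 2 + 1 / σ * ‖z - z'‖ ^ 2
    - γ / 2 * (lam * ‖app A (x - x') + app B (z - z')‖ ^ 2)

@[fun_prop]
lemma continuous_lyapunov (x' : Vec (Fin n)) (z' : Vec (Fin l)) (y' : Vec (Fin m)) :
    Continuous fun w : Vec (Fin n) × Vec (Fin l) × Vec (Fin m) =>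
      lyapunov A B lam τ σ γ x' z' y' w.1 w.2.1 w.2.2 := by
  unfold lyapunov
  fun_prop

lemma lyapunov_self (x' : Vec (Fin n)) (z' : Vec (Fin l)) (y' : Vec (Fin m)) :
    lyapunov A B lam τ σ γ x' z' y' x' z' y' = 0 := by
  simp [lyapunov, app_eq_toEuclideanLin]

lemma le_lyapunov (hlam : 0 < lam) (hτ : 0 < τ) (hσ : 0 < σ) (hγ : 0 < γ)
    (x' : Vec (Fin n)) (z' : Vec (Fin l)) (y' : Vec (Fin m))
    (x : Vec (Fin n)) (z : Vec (Fin l)) (y : Vec (Fin m)) :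
    1 / (γ * lam) * ‖y - y'‖ ^ 2 +
      (1 - γ / 2 * (lam * τ * specNorm (Aᵀ * A) + lam * σ * specNorm (Bᵀ * B))) *
        (1 / τ * ‖x - x'‖ ^ 2 + 1 / σ * ‖z - z'‖ ^ 2) ≤
      lyapunov A B lam τ σ γ x' z' y' x z y := by
  have h := mul_le_mul_of_nonneg_left
    (norm_app_add_app_sq_le A B hlam hτ hσ (x - x') (z - z')) (by positivity : 0 ≤ γ / 2)
  rw [lyapunov]
  linarith

/-- One step of the method from `(x, z, y)` to `(x₁, z₁, y₁)` against a KKT point `(x', z', y')`.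
Monotonicity of the two subdifferentials bounds the increase of the Lyapunov function by
`-‖Δ‖² + lam (γ/2 (‖r₁‖² + ‖r‖²) - 2 ⟨r₁, r⟩)`, where `r` and `r₁` are the residuals and `‖Δ‖²` is
the weighted squared length of the primal step. The parallelogram law splits the last bracket into
multiples of `‖r₁ - r‖²` and `‖r₁ + r‖²`. -/
lemma lyapunov_step (hlam : 0 < lam) (hγ : 0 < γ)
    (hf : ClosedProperConvex f) (hg : ClosedProperConvex g)
    {x' : Vec (Fin n)} {z' : Vec (Fin l)} {y' : Vec (Fin m)} (h' : IsKKT f g A B b x' z' y')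
    {x x₁ : Vec (Fin n)} {z z₁ : Vec (Fin l)} {y y₁ : Vec (Fin m)}
    (hx : HasSubgradientAt f
      (-app Aᵀ (predictor A B b lam x z y) - (1 / τ) • (x₁ - x)) x₁)
    (hz : HasSubgradientAt g
      (-app Bᵀ (predictor A B b lam x z y) - (1 / σ) • (z₁ - z)) z₁)
    (hy : y₁ = y + (γ * lam) • (app A x₁ + app B z₁ - b)) :
    lyapunov A B lam τ σ γ x' z' y' x₁ z₁ y₁ + (1 / τ * ‖x₁ - x‖ ^ 2 + 1 / σ * ‖z₁ - z‖ ^ 2)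
        + (2 - γ) / 4 *
          (lam * ‖(app A x₁ + app B z₁ - b) + (app A x + app B z - b)‖ ^ 2) ≤
      lyapunov A B lam τ σ γ x' z' y' x z y
        + (2 + γ) / 4 * (lam * ‖app A (x₁ - x) + app B (z₁ - z)‖ ^ 2) := by
  have hmx := hx.inner_nonneg hf h'.subgradient_x
  have hmz := hz.inner_nonneg hg h'.subgradient_z
  set p := predictor A B b lam x z y
  set r := app A x + app B z - b with hr
  set r₁ := app A x₁ + app B z₁ - b with hr₁
  have er : app A (x - x') + app B (z - z') = r := by
    rw [app_sub, app_sub, hr, ← h'.feasible]; abel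
  have er₁ : app A (x₁ - x') + app B (z₁ - z') = r₁ := by
    rw [app_sub, app_sub, hr₁, ← h'.feasible]; abel
  have eΔ : app A (x₁ - x) + app B (z₁ - z) = r₁ - r := by
    rw [app_sub, app_sub, hr₁, hr]; abel
  have ep : p = y + lam • r := rfl
  -- The sum of the two monotonicity inequalities.
  have hmono : 1 / τ * inner ℝ (x₁ - x) (x₁ - x') + 1 / σ * inner ℝ (z₁ - z) (z₁ - z') ≤
      -inner ℝ (y - y') r₁ - lam * inner ℝ r r₁ := by
    have e : inner ℝ (app Aᵀ p) (x₁ - x') - inner ℝ (app Aᵀ y') (x₁ - x') +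
        (inner ℝ (app Bᵀ p) (z₁ - z') - inner ℝ (app Bᵀ y') (z₁ - z')) =
        inner ℝ (y - y') r₁ + lam * inner ℝ r r₁ := by
      simp only [← inner_app_right]
      rw [← er₁, ep]
      simp only [inner_add_left, inner_add_right, inner_sub_left, real_inner_smul_left]
      ring
    simp only [inner_sub_left, inner_neg_left, real_inner_smul_left] at hmx hmz
    simp only [inner_sub_left] at e ⊢
    linarith
  have ex : ‖x₁ - x'‖ ^ 2 = ‖x - x'‖ ^ 2 + 2 * inner ℝ (x₁ - x) (x₁ - x') - ‖x₁ - x‖ ^ 2 := by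
    have : x - x' = (x₁ - x') - (x₁ - x) := by abel
    rw [this, norm_sub_sq_real (x₁ - x'), real_inner_comm (x₁ - x) (x₁ - x')]; ring
  have ez : ‖z₁ - z'‖ ^ 2 = ‖z - z'‖ ^ 2 + 2 * inner ℝ (z₁ - z) (z₁ - z') - ‖z₁ - z‖ ^ 2 := by
    have : z - z' = (z₁ - z') - (z₁ - z) := by abel
    rw [this, norm_sub_sq_real (z₁ - z'), real_inner_comm (z₁ - z) (z₁ - z')]; ring
  have ey : 1 / (γ * lam) * ‖y₁ - y'‖ ^ 2 = 1 / (γ * lam) * ‖y - y'‖ ^ 2 +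
      2 * inner ℝ (y - y') r₁ + γ * (lam * ‖r₁‖ ^ 2) := by
    have : y₁ - y' = (y - y') + (γ * lam) • r₁ := by rw [hy]; abel
    rw [this, norm_add_sq_real (y - y'), inner_smul_right, norm_smul, mul_pow, Real.norm_eq_abs, sq_abs]
    have : γ * lam ≠ 0 := (mul_pos hγ hlam).ne'
    field_simp
  rw [lyapunov, lyapunov, er, er₁, eΔ, ex, ez, ey, norm_add_sq_real r₁ r, norm_sub_sq_real r₁ r,
    real_inner_comm r r₁]
  linarith

lemma tendsto_of_mul_norm_sub_sq_le {E : Type*} [SeminormedAddCommGroup E] {u : ℕ → E} {u' : E}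
    {a : ℝ} {ε : ℕ → ℝ} (ha : 0 < a) (h : ∀ k, a * ‖u k - u'‖ ^ 2 ≤ ε k)
    (hε : Tendsto ε atTop (𝓝 0)) : Tendsto u atTop (𝓝 u') := by
  rw [tendsto_iff_norm_sub_tendsto_zero]
  have h₁ : Tendsto (fun k => √(ε k / a)) atTop (𝓝 0) := by
    have := (Real.continuous_sqrt.tendsto _).comp (hε.div_const a)
    rwa [zero_div, Real.sqrt_zero] at this
  refine squeeze_zero (fun k => norm_nonneg _) (fun k => Real.le_sqrt_of_sq_le ?_) h₁
  rw [le_div_iff₀' ha]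
  exact h k

/-- Every run of the method converges to a KKT point, provided that a KKT point exists. -/
theorem IsGPCPM3Run.exists_tendsto (hlam : 0 < lam) (hτ : 0 < τ) (hσ : 0 < σ)
    (hγ : γ ∈ Ioo (0 : ℝ) 2) (hf : ClosedProperConvex f) (hg : ClosedProperConvex g)
    (hkkt : ∃ x z y, IsKKT f g A B b x z y)
    (hstep : lam * τ * specNorm (Aᵀ * A) + lam * σ * specNorm (Bᵀ * B) < 4 / (2 + γ))
    {x : ℕ → Vec (Fin n)} {z : ℕ → Vec (Fin l)} {y : ℕ → Vec (Fin m)}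
    (h : IsGPCPM3Run f g A B b lam τ σ γ x z y) :
    ∃ x' z' y', IsKKT f g A B b x' z' y' ∧
      Tendsto x atTop (𝓝 x') ∧ Tendsto z atTop (𝓝 z') ∧ Tendsto y atTop (𝓝 y') := by
  obtain ⟨hγ₀, hγ₂⟩ := hγ
  set K := lam * τ * specNorm (Aᵀ * A) + lam * σ * specNorm (Bᵀ * B) with hK
  have hK₁ : (2 + γ) / 4 * K < 1 := by
    rw [lt_div_iff₀ (by linarith)] at hstep
    linarith
  have hK₀ : 0 ≤ K := by
    have h₁ : 0 ≤ specNorm (Aᵀ * A) := norm_nonneg _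
    have h₂ : 0 ≤ specNorm (Bᵀ * B) := norm_nonneg _
    positivity
  -- `γ / 2 ≤ (2 + γ) / 4` because `γ ≤ 2`, so the Lyapunov function is coercive.
  have hK₂ : 0 < 1 - γ / 2 * K := by nlinarith
  set c := 1 - (2 + γ) / 4 * K with hc
  have hc₀ : 0 < c := sub_pos.2 hK₁
  have hsubx : ∀ k, HasSubgradientAt f
      (-app Aᵀ (predictor A B b lam (x k) (z k) (y k)) - (1 / τ) • (x (k + 1) - x k))
      (x (k + 1)) := fun k => by
    have := h.step_x k
    simp only [inner_app_right] at this
    exact hf.hasSubgradientAt_of_isMinOn this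
  have hsubz : ∀ k, HasSubgradientAt g
      (-app Bᵀ (predictor A B b lam (x k) (z k) (y k)) - (1 / σ) • (z (k + 1) - z k))
      (z (k + 1)) := fun k => by
    have := h.step_z k
    simp only [inner_app_right] at this
    exact hg.hasSubgradientAt_of_isMinOn this
  set r : ℕ → Vec (Fin m) := fun k => app A (x k) + app B (z k) - b with hr
  set Δ : ℕ → ℝ := fun k => 1 / τ * ‖x (k + 1) - x k‖ ^ 2 + 1 / σ * ‖z (k + 1) - z k‖ ^ 2 with hΔ
  have hΔ₀ : ∀ k, 0 ≤ Δ k := fun k => by positivity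
  have hdecr : ∀ {x' z' y'}, IsKKT f g A B b x' z' y' → ∀ k,
      lyapunov A B lam τ σ γ x' z' y' (x (k + 1)) (z (k + 1)) (y (k + 1)) +
        (c * Δ k + (2 - γ) / 4 * lam * ‖r (k + 1) + r k‖ ^ 2) ≤
      lyapunov A B lam τ σ γ x' z' y' (x k) (z k) (y k) := by
    intro x' z' y' h' k
    have h₁ := lyapunov_step (γ := γ) hlam hγ₀ hf hg h' (hsubx k) (hsubz k) (h.step_y k)
    have h₂ := mul_le_mul_of_nonneg_left
      (norm_app_add_app_sq_le A B hlam hτ hσ (x (k + 1) - x k) (z (k + 1) - z k))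
      (by linarith : 0 ≤ (2 + γ) / 4)
    simp only [hΔ, hr, hc, hK]
    linarith
  have hanti : ∀ {x' z' y'}, IsKKT f g A B b x' z' y' →
      Antitone fun k => lyapunov A B lam τ σ γ x' z' y' (x k) (z k) (y k) := fun h' =>
    antitone_nat_of_succ_le fun k => by
      have h₁ := hdecr h' k
      have h₂ : 0 ≤ (2 - γ) / 4 * lam * ‖r (k + 1) + r k‖ ^ 2 :=
        mul_nonneg (mul_nonneg (by linarith) hlam.le) (sq_nonneg _)
      have h₃ := mul_nonneg hc₀.le (hΔ₀ k)
      linarith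
  have hnonneg : ∀ x' z' y' k, 0 ≤ lyapunov A B lam τ σ γ x' z' y' (x k) (z k) (y k) :=
    fun x' z' y' k => le_trans (by positivity) (le_lyapunov hlam hτ hσ hγ₀ x' z' y' _ _ _)
  -- Each component of the distance to the reference point is controlled by the Lyapunov function.
  set a := 1 / (γ * lam) with ha
  set d := 1 - γ / 2 * K with hd
  have ha₀ : 0 < a := by positivity
  have hτ₀ : 0 < d * (1 / τ) := by positivity
  have hσ₀ : 0 < d * (1 / σ) := by positivity
  have hcoer : ∀ x' z' y' k,
      d * (1 / τ) * ‖x k - x'‖ ^ 2 ≤ lyapunov A B lam τ σ γ x' z' y' (x k) (z k) (y k) ∧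
      d * (1 / σ) * ‖z k - z'‖ ^ 2 ≤ lyapunov A B lam τ σ γ x' z' y' (x k) (z k) (y k) ∧
      a * ‖y k - y'‖ ^ 2 ≤ lyapunov A B lam τ σ γ x' z' y' (x k) (z k) (y k) := by
    intro x' z' y' k
    have h₁ := le_lyapunov (A := A) (B := B) hlam hτ hσ hγ₀ x' z' y' (x k) (z k) (y k)
    rw [← hK, ← hd, ← ha] at h₁
    have h₂ : 0 ≤ d * (1 / τ) * ‖x k - x'‖ ^ 2 := by positivity
    have h₃ : 0 ≤ d * (1 / σ) * ‖z k - z'‖ ^ 2 := by positivity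
    have h₄ : 0 ≤ a * ‖y k - y'‖ ^ 2 := by positivity
    refine ⟨?_, ?_, ?_⟩ <;> linarith
  obtain ⟨x₀, z₀, y₀, h₀⟩ := hkkt
  -- The decrements of the Lyapunov function at a KKT point tend to zero.
  obtain ⟨ε, hε, hεle⟩ : ∃ ε : ℕ → ℝ, Tendsto ε atTop (𝓝 0) ∧
      ∀ k, c * Δ k + (2 - γ) / 4 * lam * ‖r (k + 1) + r k‖ ^ 2 ≤ ε k := by
    have hlim := tendsto_atTop_ciInf (hanti h₀) ⟨0, by rintro _ ⟨k, rfl⟩; exact hnonneg _ _ _ k⟩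
    refine ⟨_, by simpa using hlim.sub (hlim.comp (tendsto_add_atTop_nat 1)), fun k => ?_⟩
    exact le_sub_iff_add_le'.2 (hdecr h₀ k)
  have hγ' : 0 < (2 - γ) / 4 * lam := mul_pos (by linarith) hlam
  have hdx : Tendsto (fun k => x (k + 1) - x k) atTop (𝓝 0) := by
    refine tendsto_of_mul_norm_sub_sq_le (by positivity : 0 < c * (1 / τ)) (fun k => ?_) hε
    have h₁ := hεle k
    have h₂ : 0 ≤ (2 - γ) / 4 * lam * ‖r (k + 1) + r k‖ ^ 2 := by positivity
    have h₃ : 0 ≤ c * (1 / σ * ‖z (k + 1) - z k‖ ^ 2) := by positivity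
    simp only [hΔ] at h₁
    rw [sub_zero]
    linarith
  have hdz : Tendsto (fun k => z (k + 1) - z k) atTop (𝓝 0) := by
    refine tendsto_of_mul_norm_sub_sq_le (by positivity : 0 < c * (1 / σ)) (fun k => ?_) hε
    have h₁ := hεle k
    have h₂ : 0 ≤ (2 - γ) / 4 * lam * ‖r (k + 1) + r k‖ ^ 2 := by positivity
    have h₃ : 0 ≤ c * (1 / τ * ‖x (k + 1) - x k‖ ^ 2) := by positivity
    simp only [hΔ] at h₁
    rw [sub_zero]
    linarith
  have hrsum : Tendsto (fun k => r (k + 1) + r k) atTop (𝓝 0) := by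
    refine tendsto_of_mul_norm_sub_sq_le hγ' (fun k => ?_) hε
    have h₁ := hεle k
    have h₂ := mul_nonneg hc₀.le (hΔ₀ k)
    rw [sub_zero]
    linarith
  -- The residual tends to zero, as `r (k + 1) + r k` and `r (k + 1) - r k` both do.
  have hr₀ : Tendsto r atTop (𝓝 0) := by
    have h₁ : Tendsto (fun k => app A (x (k + 1) - x k) + app B (z (k + 1) - z k)) atTop
        (𝓝 (app A 0 + app B 0)) :=
      (((continuous_app A).tendsto 0).comp hdx).add (((continuous_app B).tendsto 0).comp hdz)
    have h₂ := (hrsum.sub h₁).const_smul (1 / 2 : ℝ)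
    simp only [app_eq_toEuclideanLin, map_zero, add_zero, sub_zero, smul_zero] at h₂
    refine h₂.congr fun k => ?_
    simp only [← app_eq_toEuclideanLin, app_sub, hr]
    module
  -- Extract a convergent subsequence of the bounded run.
  set W := lyapunov A B lam τ σ γ x₀ z₀ y₀ (x 0) (z 0) (y 0)
  have hWle : ∀ k, lyapunov A B lam τ σ γ x₀ z₀ y₀ (x k) (z k) (y k) ≤ W := fun k =>
    hanti h₀ (Nat.zero_le k)
  have hbdd : ∀ k, (x k, z k, y k) ∈ Metric.closedBall x₀ (√(W / (d * (1 / τ)))) ×ˢ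
      Metric.closedBall z₀ (√(W / (d * (1 / σ)))) ×ˢ Metric.closedBall y₀ (√(W / a)) := by
    intro k
    obtain ⟨h₁, h₂, h₃⟩ := hcoer x₀ z₀ y₀ k
    refine ⟨?_, ?_, ?_⟩ <;> rw [mem_closedBall_iff_norm] <;> refine Real.le_sqrt_of_sq_le ?_
    · rw [le_div_iff₀' hτ₀]; exact h₁.trans (hWle k)
    · rw [le_div_iff₀' hσ₀]; exact h₂.trans (hWle k)
    · rw [le_div_iff₀' ha₀]; exact h₃.trans (hWle k)
  obtain ⟨⟨x', z', y'⟩, -, φ, hφ, hlim⟩ := tendsto_subseq_of_bounded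
    (Metric.isBounded_closedBall.prod (Metric.isBounded_closedBall.prod
      Metric.isBounded_closedBall)) hbdd
  have hφ' := hφ.tendsto_atTop
  have hlx : Tendsto (fun k => x (φ k)) atTop (𝓝 x') := (continuous_fst.tendsto _).comp hlim
  have hlz : Tendsto (fun k => z (φ k)) atTop (𝓝 z') :=
    ((continuous_fst.comp continuous_snd).tendsto _).comp hlim
  have hly : Tendsto (fun k => y (φ k)) atTop (𝓝 y') :=
    ((continuous_snd.comp continuous_snd).tendsto _).comp hlim
  have hlx₁ : Tendsto (fun k => x (φ k + 1)) atTop (𝓝 x') := by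
    simpa using hlx.add (hdx.comp hφ')
  have hlz₁ : Tendsto (fun k => z (φ k + 1)) atTop (𝓝 z') := by
    simpa using hlz.add (hdz.comp hφ')
  have hlp : Tendsto (fun k => predictor A B b lam (x (φ k)) (z (φ k)) (y (φ k))) atTop
      (𝓝 y') := by
    have := hly.add ((hr₀.comp hφ').const_smul lam)
    rw [smul_zero, add_zero] at this
    exact this
  have h' : IsKKT f g A B b x' z' y' := by
    refine ⟨?_, ?_, ?_⟩
    · have h₁ : Tendsto (fun k => r (φ k)) atTop (𝓝 (app A x' + app B z' - b)) :=
        ((((continuous_app A).tendsto _).comp hlx).add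
          (((continuous_app B).tendsto _).comp hlz)).sub_const b
      exact sub_eq_zero.1 (tendsto_nhds_unique h₁ (hr₀.comp hφ'))
    · refine HasSubgradientAt.of_tendsto hf (fun k => hsubx (φ k)) ?_ hlx₁
      have := (((continuous_app Aᵀ).tendsto _).comp hlp).neg.sub
        ((hdx.comp hφ').const_smul (1 / τ))
      rw [smul_zero, sub_zero] at this
      exact this
    · refine HasSubgradientAt.of_tendsto hg (fun k => hsubz (φ k)) ?_ hlz₁
      have := (((continuous_app Bᵀ).tendsto _).comp hlp).neg.sub
        ((hdz.comp hφ').const_smul (1 / σ))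
      rw [smul_zero, sub_zero] at this
      exact this
  -- The Lyapunov function at the limit point is antitone and vanishes along the subsequence.
  have hV : Tendsto (fun k => lyapunov A B lam τ σ γ x' z' y' (x k) (z k) (y k)) atTop (𝓝 0) := by
    have h₁ := tendsto_atTop_ciInf (hanti h') ⟨0, by rintro _ ⟨k, rfl⟩; exact hnonneg _ _ _ k⟩
    have h₂ := ((continuous_lyapunov (A := A) (B := B) (lam := lam) (τ := τ) (σ := σ) (γ := γ)
      x' z' y').tendsto (x', z', y')).comp hlim
    simp only [lyapunov_self] at h₂
    rwa [tendsto_nhds_unique (h₁.comp hφ') h₂] at h₁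
  exact ⟨x', z', y', h',
    tendsto_of_mul_norm_sub_sq_le hτ₀ (fun k => (hcoer x' z' y' k).1) hV,
    tendsto_of_mul_norm_sub_sq_le hσ₀ (fun k => (hcoer x' z' y' k).2.1) hV,
    tendsto_of_mul_norm_sub_sq_le ha₀ (fun k => (hcoer x' z' y' k).2.2) hV⟩

end Convergence

end PCPM

theorem mainTheorem3 {n l m : ℕ}
    (f : PCPM.Vec (Fin n) → EReal) (g : PCPM.Vec (Fin l) → EReal)
    (hf : PCPM.ClosedProperConvex f) (hg : PCPM.ClosedProperConvex g)
    (A : Matrix (Fin m) (Fin n) ℝ) (B : Matrix (Fin m) (Fin l) ℝ) (b : PCPM.Vec (Fin m))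
    (lam τ σ γ : ℝ) (hlam : 0 < lam) (hτ : 0 < τ) (hσ : 0 < σ) (hγ : γ ∈ Ioo (0 : ℝ) 2) :
    -- the method is well defined: every starting point gives exactly one run
    (∀ (x₀ : PCPM.Vec (Fin n)) (z₀ : PCPM.Vec (Fin l)) (y₀ : PCPM.Vec (Fin m)),
      ∃! w : ℕ → PCPM.Vec (Fin n) × PCPM.Vec (Fin l) × PCPM.Vec (Fin m),
        w 0 = (x₀, z₀, y₀) ∧
        PCPM.IsGPCPM3Run f g A B b lam τ σ γ
          (fun k => (w k).1) (fun k => (w k).2.1) (fun k => (w k).2.2)) ∧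
    -- it is the proximal ALM for `min {θ u : [A B] u = b}` with proximal matrix `P`
    (∀ (x : ℕ → PCPM.Vec (Fin n)) (z : ℕ → PCPM.Vec (Fin l)) (y : ℕ → PCPM.Vec (Fin m)),
      PCPM.IsGPCPM3Run f g A B b lam τ σ γ x z y ↔
        PCPM.IsProximalALMRun (PCPM.sepObjective f g) (Matrix.fromCols A B) b lam γ
          (PCPM.proxMatrix A B lam τ σ) (fun k => PCPM.stack (x k) (z k)) y) ∧
    -- the block form of `P`
    (PCPM.proxMatrix A B lam τ σ =
      Matrix.fromBlocks ((1 / τ) • 1 - lam • (Aᵀ * A)) (-(lam • (Aᵀ * B)))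
        (-(lam • (Bᵀ * A))) ((1 / σ) • 1 - lam • (Bᵀ * B))) ∧
    -- global convergence under the step size condition
    ((∃ x z, PCPM.IsSolution f g A B b x z) →
      (((∀ x, f x ≠ ⊤) ∧ ∀ z, g z ≠ ⊤) ∨ ∃ x z y, PCPM.IsSaddle f g A B b x z y) →
      lam * τ * PCPM.specNorm (Aᵀ * A) + lam * σ * PCPM.specNorm (Bᵀ * B) < 4 / (2 + γ) →
      ∀ (x : ℕ → PCPM.Vec (Fin n)) (z : ℕ → PCPM.Vec (Fin l)) (y : ℕ → PCPM.Vec (Fin m)),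
        PCPM.IsGPCPM3Run f g A B b lam τ σ γ x z y →
        ∃ x' z' y', PCPM.IsSolution f g A B b x' z' ∧ PCPM.IsSaddle f g A B b x' z' y' ∧
          Tendsto x atTop (𝓝 x') ∧ Tendsto z atTop (𝓝 z') ∧ Tendsto y atTop (𝓝 y')) := by
  refine ⟨fun x₀ z₀ y₀ => PCPM.existsUnique_isGPCPM3Run hf hg A B b lam γ hτ hσ (x₀, z₀, y₀),
    PCPM.isGPCPM3Run_iff_isProximalALMRun hf hg A B b lam τ σ γ,
    PCPM.proxMatrix_eq_fromBlocks A B lam τ σ, ?_⟩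
  rintro ⟨x₀, z₀, hsol⟩ hmult hstep x z y hrun
  have hkkt : ∃ x z y, PCPM.IsKKT f g A B b x z y := by
    rcases hmult with ⟨hffin, hgfin⟩ | ⟨x', z', y', h⟩
    · obtain ⟨y', h⟩ := hsol.exists_isKKT hf hg hffin hgfin
      exact ⟨x₀, z₀, y', h⟩
    · exact ⟨x', z', y', h.isKKT hf hg⟩
  obtain ⟨x', z', y', h, hx, hz, hy⟩ :=
    hrun.exists_tendsto hlam hτ hσ hγ hf hg hkkt hstep
  exact ⟨x', z', y', h.isSolution hf hg, h.isSaddle hf hg, hx, hz, hy⟩
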